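/- Let $d\ge 1$. Let $\tilde P_1^{(1)},\tilde P_2^{(1)}\in\mathbb R^{d\times d}$ and $\tilde P_c^{(2)}\in\mathbb R^{2d\times 2d}$ be symmetric positive definite matrices, and let $\tilde P_1^{(2)},\tilde P_2^{(2)}$ be the two diagonal $d\times d$ blocks of $\tilde P_c^{(2)}$. Let $H=\begin{bmatrix} I_d\\ I_d\end{bmatrix}\in\mathbb R^{2d\times d}$. For a positive definite $P\in\mathbb R^{d\times d}$ let $\mathcal E(P)=\{x\in\mathbb R^d : x^{T}P^{-1}x\le 1\}$. Say that $\mathcal E(P)$ tightly circumscribes a set $V\subseteq\mathbb R^d$ if $V\subseteq\mathcal E(P)$ and, for every positive definite $Q$, $V\subseteq\mathcal E(Q)\subseteq\mathcal E(P)$ implies $Q=P$. Let $\mathcal A_{\mathrm{ESCI}}$ be the set of all matrices $P_c^{(1)}+\tilde P_c^{(2)}$, where $P_c^{(1)}\in\mathbb R^{2d\times 2d}$ is symmetric positive semidefinite with diagonal $d\times d$ blocks $\tilde P_1^{(1)}$ and $\tilde P_2^{(1)}$. For $P_c\in\mathcal A_{\mathrm{ESCI}}$ let $\tilde P_F^*(P_c)=(H^{T}P_c^{-1}H)^{-1}$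 and $\tilde M_F^*(P_c)=\tilde P_F^*(P_c)^{-1}$, and put $$\mathcal V(\mathcal A_{\mathrm{ESCI}})=\bigcup_{P_c\in\mathcal A_{\mathrm{ESCI}}}\mathcal E\big(\tilde P_F^*(P_c)\big),\qquad g(x)=\min_{P_c\in\mathcal A_{\mathrm{ESCI}}}x^{T}\tilde M_F^*(P_c)\,x\quad(x\in\mathbb R^d).$$ For $0<\omega<1$ let $$B_F^{\mathrm{ESCI}}(\omega)=\left(H^{T}\left(\begin{bmatrix}\tfrac1\omega\tilde P_1^{(1)}&0\\0&\tfrac1{1-\omega}\tilde P_2^{(1)}\end{bmatrix}+\tilde P_c^{(2)}\right)^{-1}H\right)^{-1},$$ extended by continuity to $[0,1]$, that is, $B_F^{\mathrm{ESCI}}(0)=\tilde P_2^{(1)}+\tilde P_2^{(2)}$ and $B_F^{\mathrm{ESCI}}(1)=\tilde P_1^{(1)}+\tilde P_1^{(2)}$; let $A_F^{\mathrm{ESCI}}(\omega)=B_F^{\mathrm{ESCI}}(\omega)^{-1}$. Then the minimum defining $g(x)$ is attained for every $x\in\mathbb R^d$, and for every $\omega_1\in[0,1]$ the ellipsoid $\mathcal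 E(B_F^{\mathrm{ESCI}}(\omega_1))$ tightly circumscribes $\mathcal V(\mathcal A_{\mathrm{ESCI}})$ if and only if there is $x\ne 0$ in $\mathbb R^d$ with $g(x)=x^{T}A_F^{\mathrm{ESCI}}(\omega_1)\,x$. -/

import Mathlib

open Matrix

namespace ESCI

/-- The ellipsoid `E(P) = {x | xᵀ P⁻¹ x ≤ 1}` of a positive definite matrix `P`. -/
def ellipsoid {d : ℕ} (P : Matrix (Fin d) (Fin d) ℝ) : Set (Fin d → ℝ) :=
  {x | x ⬝ᵥ (P⁻¹ *ᵥ x) ≤ 1}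

/-- The ellipsoid `E(P)` tightly circumscribes `V`: it contains `V`, and no other ellipsoid lies
between `V` and `E(P)`. Ellipsoids are those of positive definite matrices. -/
def TightlyCircumscribes {d : ℕ} (P : Matrix (Fin d) (Fin d) ℝ) (V : Set (Fin d → ℝ)) : Prop :=
  P.PosDef ∧ V ⊆ ellipsoid P ∧
    ∀ Q : Matrix (Fin d) (Fin d) ℝ, Q.PosDef → V ⊆ ellipsoid Q → ellipsoid Q ⊆ ellipsoid P → P = Q

/-- The centralized observation matrix `H = [I; I]` of two estimators. -/
def obs (d : ℕ) : Matrix (Fin d ⊕ Fin d) (Fin d) ℝ :=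
  fromRows 1 1

/-- The covariance `(Hᵀ P⁻¹ H)⁻¹` of the optimal linear fusion of two estimators whose
centralized error covariance is `P`. -/
noncomputable def optFusedCov {d : ℕ} (P : Matrix (Fin d ⊕ Fin d) (Fin d ⊕ Fin d) ℝ) :
    Matrix (Fin d) (Fin d) ℝ :=
  ((obs d)ᵀ * P⁻¹ * obs d)⁻¹

/-- The minimal volume `V(A)`: the union of the ellipsoids of the optimal fused covariances over
the set `A` of admissible centralized covariances. -/
def minimalVolume {d : ℕ} (A : Set (Matrix (Fin d ⊕ Fin d) (Fin d ⊕ Fin d) ℝ)) :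
    Set (Fin d → ℝ) :=
  ⋃ P ∈ A, ellipsoid (optFusedCov P)

/-- The values `xᵀ M(P) x`, where `M(P)` is the inverse of the optimal fused covariance and `P`
runs over the set `A` of admissible centralized covariances. -/
def precisionValues {d : ℕ} (A : Set (Matrix (Fin d ⊕ Fin d) (Fin d ⊕ Fin d) ℝ))
    (x : Fin d → ℝ) : Set ℝ :=
  (fun P => x ⬝ᵥ ((optFusedCov P)⁻¹ *ᵥ x)) '' A

/-- The function `g`, the least of the values `xᵀ M(P) x` for `P ∈ A`. -/
noncomputable def g {d : ℕ} (A : Set (Matrix (Fin d ⊕ Fin d) (Fin d ⊕ Fin d) ℝ))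
    (x : Fin d → ℝ) : ℝ :=
  sInf (precisionValues A x)

/-- The admissible centralized covariances: the first error components have known covariances
`P₁`, `P₂` and unknown cross-covariance, the second ones have known joint covariance `Pc`. -/
def admissible {d : ℕ} (P₁ P₂ : Matrix (Fin d) (Fin d) ℝ)
    (Pc : Matrix (Fin d ⊕ Fin d) (Fin d ⊕ Fin d) ℝ) :
    Set (Matrix (Fin d ⊕ Fin d) (Fin d ⊕ Fin d) ℝ) :=
  {P | ∃ R : Matrix (Fin d ⊕ Fin d) (Fin d ⊕ Fin d) ℝ,
    R.PosSemidef ∧ R.toBlocks₁₁ = P₁ ∧ R.toBlocks₂₂ = P₂ ∧ P = R + Pc}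

/-- The centralized ESCI bound `diag(P₁ / ω, P₂ / (1 - ω)) + Pc`, meaningful for `0 < ω < 1`. -/
noncomputable def centralBound {d : ℕ} (P₁ P₂ : Matrix (Fin d) (Fin d) ℝ)
    (Pc : Matrix (Fin d ⊕ Fin d) (Fin d ⊕ Fin d) ℝ) (ω : ℝ) :
    Matrix (Fin d ⊕ Fin d) (Fin d ⊕ Fin d) ℝ :=
  fromBlocks (ω⁻¹ • P₁) 0 0 ((1 - ω)⁻¹ • P₂) + Pc

/-- The fused ESCI bound `B_F(ω)`: `(Hᵀ B(ω)⁻¹ H)⁻¹` with the centralized bound `B(ω)` if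
`0 < ω < 1`, extended to `[0, 1]` by continuity. An estimator of weight `0` is left out, so the
value at an endpoint is the full error covariance of the other one; see
`tendsto_fusedBound_zero` and `tendsto_fusedBound_one`. -/
noncomputable def fusedBound {d : ℕ} (P₁ P₂ : Matrix (Fin d) (Fin d) ℝ)
    (Pc : Matrix (Fin d ⊕ Fin d) (Fin d ⊕ Fin d) ℝ) (ω : ℝ) : Matrix (Fin d) (Fin d) ℝ :=
  if ω = 0 then P₂ + Pc.toBlocks₂₂
  else if ω = 1 then P₁ + Pc.toBlocks₁₁
  else ((obs d)ᵀ * (centralBound P₁ P₂ Pc ω)⁻¹ * obs d)⁻¹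

/-- The precision matrix `A_F(ω) = B_F(ω)⁻¹` of the fused ESCI bound. -/
noncomputable def fusedPrecision {d : ℕ} (P₁ P₂ : Matrix (Fin d) (Fin d) ℝ)
    (Pc : Matrix (Fin d ⊕ Fin d) (Fin d ⊕ Fin d) ℝ) (ω : ℝ) : Matrix (Fin d) (Fin d) ℝ :=
  (fusedBound P₁ P₂ Pc ω)⁻¹

open Filter Topology

/-- The matrix `Z(ω)` with `B(ω) = Z(ω) diag(ω I, (1 - ω) I)⁻¹`, regular on all of `[0, 1]`. -/
def centralFactor {d : ℕ} (P₁ P₂ : Matrix (Fin d) (Fin d) ℝ)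
    (Pc : Matrix (Fin d ⊕ Fin d) (Fin d ⊕ Fin d) ℝ) (ω : ℝ) :
    Matrix (Fin d ⊕ Fin d) (Fin d ⊕ Fin d) ℝ :=
  fromBlocks (P₁ + ω • Pc.toBlocks₁₁) ((1 - ω) • Pc.toBlocks₁₂)
    (ω • Pc.toBlocks₂₁) (P₂ + (1 - ω) • Pc.toBlocks₂₂)

theorem inv_centralBound {d : ℕ} (P₁ P₂ : Matrix (Fin d) (Fin d) ℝ)
    (Pc : Matrix (Fin d ⊕ Fin d) (Fin d ⊕ Fin d) ℝ) {ω : ℝ} (h0 : ω ≠ 0) (h1 : ω ≠ 1) :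
    (centralBound P₁ P₂ Pc ω)⁻¹ =
      fromBlocks (ω • 1) 0 0 ((1 - ω) • 1) * (centralFactor P₁ P₂ Pc ω)⁻¹ := by
  have h1' : 1 - ω ≠ 0 := sub_ne_zero.2 (Ne.symm h1)
  have e : centralBound P₁ P₂ Pc ω = centralFactor P₁ P₂ Pc ω *
      fromBlocks (ω⁻¹ • (1 : Matrix (Fin d) (Fin d) ℝ)) 0 0 ((1 - ω)⁻¹ • 1) := by
    conv_lhs => rw [centralBound, ← fromBlocks_toBlocks Pc]
    simp [centralFactor, fromBlocks_multiply, fromBlocks_add, smul_smul, h0, h1']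
  rw [e, Matrix.mul_inv_rev]
  congr 1
  apply Matrix.inv_eq_right_inv
  simp [fromBlocks_multiply, smul_smul, h0, h1']

theorem continuousAt_inv {n : Type*} [Fintype n] [DecidableEq n] {M : ℝ → Matrix n n ℝ} {t : ℝ}
    (hM : ContinuousAt M t) (h : (M t).det ≠ 0) : ContinuousAt (fun s => (M s)⁻¹) t := by
  have hd : ContinuousAt (fun s => (M s).det) t :=
    (Continuous.matrix_det continuous_id).continuousAt.comp hM
  have ha : ContinuousAt (fun s => (M s).adjugate) t :=
    (Continuous.matrix_adjugate continuous_id).continuousAt.comp hM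
  simp only [Matrix.inv_def, Ring.inverse_eq_inv']
  exact (hd.inv₀ h).smul ha

/-- The common form of `A_F` near the endpoints. -/
theorem continuousAt_aux {d : ℕ} (P₁ P₂ : Matrix (Fin d) (Fin d) ℝ)
    (Pc : Matrix (Fin d ⊕ Fin d) (Fin d ⊕ Fin d) ℝ) {t : ℝ}
    (h : (centralFactor P₁ P₂ Pc t).det ≠ 0) :
    ContinuousAt (fun ω : ℝ => (obs d)ᵀ * (fromBlocks (ω • 1) 0 0 ((1 - ω) • 1) *
      (centralFactor P₁ P₂ Pc ω)⁻¹) * obs d) t := by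
  have hZ : ContinuousAt (centralFactor P₁ P₂ Pc) t := by
    apply Continuous.continuousAt
    unfold centralFactor
    fun_prop
  have hD : ContinuousAt (fun ω : ℝ => fromBlocks (ω • (1 : Matrix (Fin d) (Fin d) ℝ)) 0 0
      ((1 - ω) • (1 : Matrix (Fin d) (Fin d) ℝ))) t := by
    apply Continuous.continuousAt
    fun_prop
  have hc : Continuous fun N : Matrix (Fin d ⊕ Fin d) (Fin d ⊕ Fin d) ℝ =>
      (obs d)ᵀ * N * obs d := by fun_prop
  exact hc.continuousAt.comp (hD.mul (continuousAt_inv hZ h))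

/-- The endpoint value of `B_F` at `0` is the limit of the values for `0 < ω < 1`. -/
theorem tendsto_fusedBound_zero {d : ℕ} {P₁ P₂ : Matrix (Fin d) (Fin d) ℝ}
    {Pc : Matrix (Fin d ⊕ Fin d) (Fin d ⊕ Fin d) ℝ}
    (hP₁ : P₁.PosDef) (hP₂ : P₂.PosDef) (hPc : Pc.PosDef) :
    Tendsto (fun ω => ((obs d)ᵀ * (centralBound P₁ P₂ Pc ω)⁻¹ * obs d)⁻¹)
      (𝓝[Set.Ioo 0 1] 0) (𝓝 (fusedBound P₁ P₂ Pc 0)) := by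
  have hS : (P₂ + Pc.toBlocks₂₂).PosDef := hP₂.add (hPc.submatrix Sum.inr_injective)
  have hSu : IsUnit (P₂ + Pc.toBlocks₂₂) := hS.isUnit
  have hPu : IsUnit P₁ := hP₁.isUnit
  have hZ0 : centralFactor P₁ P₂ Pc 0 =
      fromBlocks P₁ Pc.toBlocks₁₂ 0 (P₂ + Pc.toBlocks₂₂) := by simp [centralFactor]
  have hdet : (centralFactor P₁ P₂ Pc 0).det ≠ 0 := by
    rw [hZ0, det_fromBlocks_zero₂₁]
    exact mul_ne_zero hP₁.det_pos.ne' hS.det_pos.ne'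
  have hval : (obs d)ᵀ * (fromBlocks ((0 : ℝ) • 1) 0 0 ((1 - 0 : ℝ) • 1) *
      (centralFactor P₁ P₂ Pc 0)⁻¹) * obs d = (P₂ + Pc.toBlocks₂₂)⁻¹ := by
    rw [hZ0, inv_fromBlocks_zero₂₁_of_isUnit_iff _ _ _ (iff_of_true hPu hSu)]
    simp [obs, fromBlocks_multiply, transpose_fromRows, fromCols_mul_fromBlocks,
      fromCols_mul_fromRows]
  have hc := continuousAt_inv (continuousAt_aux P₁ P₂ Pc hdet)
    (by rw [hval]; exact hS.inv.det_pos.ne')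
  have hlim := hc.tendsto.mono_left (nhdsWithin_le_nhds (s := Set.Ioo (0 : ℝ) 1))
  rw [hval, nonsing_inv_nonsing_inv _ hS.det_pos.ne'.isUnit] at hlim
  have h0 : fusedBound P₁ P₂ Pc 0 = P₂ + Pc.toBlocks₂₂ := by simp [fusedBound]
  rw [h0]
  refine hlim.congr' ?_
  filter_upwards [self_mem_nhdsWithin] with ω hω
  rw [inv_centralBound P₁ P₂ Pc hω.1.ne' hω.2.ne]

/-- The endpoint value of `B_F` at `1` is the limit of the values for `0 < ω < 1`. -/
theorem tendsto_fusedBound_one {d : ℕ} {P₁ P₂ : Matrix (Fin d) (Fin d) ℝ}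
    {Pc : Matrix (Fin d ⊕ Fin d) (Fin d ⊕ Fin d) ℝ}
    (hP₁ : P₁.PosDef) (hP₂ : P₂.PosDef) (hPc : Pc.PosDef) :
    Tendsto (fun ω => ((obs d)ᵀ * (centralBound P₁ P₂ Pc ω)⁻¹ * obs d)⁻¹)
      (𝓝[Set.Ioo 0 1] 1) (𝓝 (fusedBound P₁ P₂ Pc 1)) := by
  have hS : (P₁ + Pc.toBlocks₁₁).PosDef := hP₁.add (hPc.submatrix Sum.inl_injective)
  have hSu : IsUnit (P₁ + Pc.toBlocks₁₁) := hS.isUnit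
  have hPu : IsUnit P₂ := hP₂.isUnit
  have hZ0 : centralFactor P₁ P₂ Pc 1 =
      fromBlocks (P₁ + Pc.toBlocks₁₁) 0 Pc.toBlocks₂₁ P₂ := by simp [centralFactor]
  have hdet : (centralFactor P₁ P₂ Pc 1).det ≠ 0 := by
    rw [hZ0, det_fromBlocks_zero₁₂]
    exact mul_ne_zero hS.det_pos.ne' hP₂.det_pos.ne'
  have hval : (obs d)ᵀ * (fromBlocks ((1 : ℝ) • 1) 0 0 ((1 - 1 : ℝ) • 1) *
      (centralFactor P₁ P₂ Pc 1)⁻¹) * obs d = (P₁ + Pc.toBlocks₁₁)⁻¹ := by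
    rw [hZ0, inv_fromBlocks_zero₁₂_of_isUnit_iff _ _ _ (iff_of_true hSu hPu)]
    simp [obs, fromBlocks_multiply, transpose_fromRows, fromCols_mul_fromBlocks,
      fromCols_mul_fromRows]
  have hc := continuousAt_inv (continuousAt_aux P₁ P₂ Pc hdet)
    (by rw [hval]; exact hS.inv.det_pos.ne')
  have hlim := hc.tendsto.mono_left (nhdsWithin_le_nhds (s := Set.Ioo (0 : ℝ) 1))
  rw [hval, nonsing_inv_nonsing_inv _ hS.det_pos.ne'.isUnit] at hlim
  have h0 : fusedBound P₁ P₂ Pc 1 = P₁ + Pc.toBlocks₁₁ := by simp [fusedBound]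
  rw [h0]
  refine hlim.congr' ?_
  filter_upwards [self_mem_nhdsWithin] with ω hω
  rw [inv_centralBound P₁ P₂ Pc hω.1.ne' hω.2.ne]

end ESCI

open Matrix Filter Topology
-- Quadratic forms of symmetric matrices
namespace Matrix

variable {n : Type*} [Fintype n]

/-! With D(ω) = diag(ω P₁⁻¹, (1 - ω) P₂⁻¹), the number xᵀ A_F(ω) x is the minimum over v of (Hx -
v)ᵀ D(ω) (Hx - v) + vᵀ Pc⁻¹ v (`objective_eq`). For fixed v this is affine in ω, so the minimum is
concave in ω; for x ≠ 0 it is strictly concave (`quadratic_regularPrecision_lt`) and has a single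
maximizer. Moreover g(x) = max_ω xᵀ A_F(ω) x: each admissible covariance gives an upper bound for
every ω (`quadratic_regularPrecision_le_of_mem_admissible`), and at the maximizer a covariance
correlated along the residual attains it (`Stationary.exists_admissible`).

Inclusions of ellipsoids are reversed inequalities of inverse forms, and V ⊆ E(Q) means Q⁻¹ ≤ g. If
the form of A_F(ω₁) stays strictly below g off 0, compactness of the sphere leaves room for A_F(ω₁)
+ ε I, so the ellipsoid is not tight. If it touches g at x ≠ 0 and E(Q) lies in between, then
A_F(ω₁) ≤ Q⁻¹ ≤ A_F(ω) for a single ω (`exists_le_regularPrecision`, a connectedness argument in the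
manner of the S-lemma). Both ω₁ and ω maximize at x, so they coincide and Q = B_F(ω₁). -/

theorem dotProduct_mulVec_comm_of_isHermitian {A : Matrix n n ℝ} (hA : A.IsHermitian)
    (v w : n → ℝ) : v ⬝ᵥ (A *ᵥ w) = w ⬝ᵥ (A *ᵥ v) := by
  have h : Aᵀ = A := hA
  rw [dotProduct_mulVec, ← mulVec_transpose, h, dotProduct_comm]

theorem PosSemidef.dotProduct_mulVec_self_nonneg {A : Matrix n n ℝ} (hA : A.PosSemidef)
    (v : n → ℝ) : 0 ≤ v ⬝ᵥ (A *ᵥ v) := by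
  simpa using hA.dotProduct_mulVec_nonneg v

theorem PosDef.dotProduct_mulVec_self_pos {A : Matrix n n ℝ} (hA : A.PosDef)
    {v : n → ℝ} (hv : v ≠ 0) : 0 < v ⬝ᵥ (A *ᵥ v) := by
  simpa using hA.dotProduct_mulVec_pos hv

theorem quadratic_smul (A : Matrix n n ℝ) (c : ℝ) (v : n → ℝ) :
    (c • v) ⬝ᵥ (A *ᵥ (c • v)) = c ^ 2 * (v ⬝ᵥ (A *ᵥ v)) := by
  simp only [mulVec_smul, smul_dotProduct, dotProduct_smul, smul_eq_mul]
  ring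

theorem quadratic_add_smul {A : Matrix n n ℝ} (hA : A.IsHermitian) (v w : n → ℝ) (t : ℝ) :
    (v + t • w) ⬝ᵥ (A *ᵥ (v + t • w)) =
      v ⬝ᵥ (A *ᵥ v) + 2 * t * (v ⬝ᵥ (A *ᵥ w)) + t ^ 2 * (w ⬝ᵥ (A *ᵥ w)) := by
  simp only [mulVec_add, mulVec_smul, add_dotProduct, dotProduct_add, smul_dotProduct,
    dotProduct_smul, smul_eq_mul, dotProduct_mulVec_comm_of_isHermitian hA w v]
  ring

/-- Two symmetric matrices with the same quadratic form are equal. -/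
theorem eq_of_quadratic_eq {A B : Matrix n n ℝ} (hA : A.IsHermitian) (hB : B.IsHermitian)
    (h : ∀ v, v ⬝ᵥ (A *ᵥ v) = v ⬝ᵥ (B *ᵥ v)) : A = B := by
  classical
  refine ext_of_mulVec_single fun j => ?_
  have key : ∀ v w, v ⬝ᵥ (A *ᵥ w) = v ⬝ᵥ (B *ᵥ w) := fun v w => by
    have := h (v + (1 : ℝ) • w)
    rw [quadratic_add_smul hA, quadratic_add_smul hB, h v, h w] at this
    linarith
  ext i
  simpa using key (Pi.single i 1) (Pi.single j 1)

variable [DecidableEq n]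

theorem PosDef.mulVec_inv_mulVec {A : Matrix n n ℝ} (hA : A.PosDef) (v : n → ℝ) :
    A *ᵥ (A⁻¹ *ᵥ v) = v := by
  rw [mulVec_mulVec, mul_nonsing_inv _ hA.det_pos.ne'.isUnit, one_mulVec]

theorem PosDef.inv_mulVec_mulVec {A : Matrix n n ℝ} (hA : A.PosDef) (v : n → ℝ) :
    A⁻¹ *ᵥ (A *ᵥ v) = v := by
  rw [mulVec_mulVec, nonsing_inv_mul _ hA.det_pos.ne'.isUnit, one_mulVec]

/-- Young's inequality for a positive definite matrix and its inverse. -/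
theorem PosDef.two_mul_dotProduct_le {A : Matrix n n ℝ} (hA : A.PosDef) (v w : n → ℝ) (t : ℝ) :
    2 * t * (w ⬝ᵥ v) ≤ v ⬝ᵥ (A *ᵥ v) + t ^ 2 * (w ⬝ᵥ (A⁻¹ *ᵥ w)) := by
  have h := PosSemidef.dotProduct_mulVec_self_nonneg hA.posSemidef (v + (-t) • (A⁻¹ *ᵥ w))
  rw [quadratic_add_smul hA.1, PosDef.mulVec_inv_mulVec hA, dotProduct_comm v w,
    dotProduct_comm _ w] at h
  linarith

/-- The rank-one bound `(w ⬝ᵥ v)² ≤ m (vᵀ A v)` when `wᵀ A⁻¹ w ≤ m`, divided by `m`. -/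
theorem PosDef.sq_dotProduct_div_le {A : Matrix n n ℝ} (hA : A.PosDef) {w : n → ℝ} {m : ℝ}
    (hm : w ⬝ᵥ (A⁻¹ *ᵥ w) ≤ m) (v : n → ℝ) : m⁻¹ * (w ⬝ᵥ v) ^ 2 ≤ v ⬝ᵥ (A *ᵥ v) := by
  have h0 := PosSemidef.dotProduct_mulVec_self_nonneg hA.inv.posSemidef w
  rcases (h0.trans hm).eq_or_lt with rfl | hpos
  -- Here m = 0, and the convention `0⁻¹ = 0` makes the left side vanish.
  · simpa using PosSemidef.dotProduct_mulVec_self_nonneg hA.posSemidef v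
  · have h := PosDef.two_mul_dotProduct_le hA v w (m⁻¹ * (w ⬝ᵥ v))
    have h2 : (m⁻¹ * (w ⬝ᵥ v)) ^ 2 * (w ⬝ᵥ (A⁻¹ *ᵥ w)) ≤ (m⁻¹ * (w ⬝ᵥ v)) ^ 2 * m := by gcongr
    have h3 : (m⁻¹ * (w ⬝ᵥ v)) ^ 2 * m = m⁻¹ * (w ⬝ᵥ v) ^ 2 := by field_simp
    nlinarith

/-- Completion of the square in the infimal convolution of two quadratic forms. -/
theorem quadratic_sub_add_quadratic {D C : Matrix n n ℝ} (hD : D.IsHermitian)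
    (hW : (D + C).PosDef) (y v : n → ℝ) :
    (y - v) ⬝ᵥ (D *ᵥ (y - v)) + v ⬝ᵥ (C *ᵥ v) =
      y ⬝ᵥ ((D - D * (D + C)⁻¹ * D) *ᵥ y) +
        (v - (D + C)⁻¹ *ᵥ (D *ᵥ y)) ⬝ᵥ ((D + C) *ᵥ (v - (D + C)⁻¹ *ᵥ (D *ᵥ y))) := by
  set u := (D + C)⁻¹ *ᵥ (D *ᵥ y) with hu
  have hWu : (D + C) *ᵥ u = D *ᵥ y := PosDef.mulVec_inv_mulVec hW _
  have e1 : (D - D * (D + C)⁻¹ * D) *ᵥ y = D *ᵥ y - D *ᵥ u := by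
    simp only [sub_mulVec, hu, mulVec_mulVec, Matrix.mul_assoc]
  have e2 := quadratic_add_smul hW.1 v u (-1)
  have e3 := quadratic_add_smul hD y v (-1)
  have e4 : u ⬝ᵥ (D *ᵥ y) = y ⬝ᵥ (D *ᵥ u) := dotProduct_mulVec_comm_of_isHermitian hD _ _
  have e5 : v ⬝ᵥ (D *ᵥ y) = y ⬝ᵥ (D *ᵥ v) := dotProduct_mulVec_comm_of_isHermitian hD _ _
  rw [hWu, e4, e5] at e2
  simp only [neg_smul, one_smul, ← sub_eq_add_neg] at e2 e3
  rw [e1, e2, e3, dotProduct_sub, add_mulVec, dotProduct_add]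
  ring

end Matrix

/-! ### The fused precision as an infimal convolution, concave in the weight -/

namespace ESCI

variable {d : ℕ} (P₁ P₂ : Matrix (Fin d) (Fin d) ℝ) (Pc : Matrix (Fin d ⊕ Fin d) (Fin d ⊕ Fin d) ℝ)

/-- The weighted precision `diag(ω P₁⁻¹, (1 - ω) P₂⁻¹)` of the first error components. -/
noncomputable def weight (ω : ℝ) : Matrix (Fin d ⊕ Fin d) (Fin d ⊕ Fin d) ℝ :=
  fromBlocks (ω • P₁⁻¹) 0 0 ((1 - ω) • P₂⁻¹)

/-- The form `Hᵀ (D - D (D + C)⁻¹ D) H` of the fused precision, with `D = weight ω`, `C = Pc⁻¹`. -/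
noncomputable def regularPrecision (ω : ℝ) : Matrix (Fin d) (Fin d) ℝ :=
  (obs d)ᵀ * (weight P₁ P₂ ω - weight P₁ P₂ ω * (weight P₁ P₂ ω + Pc⁻¹)⁻¹ * weight P₁ P₂ ω) * obs d

/-- The part `u` of `H x` that minimizes `(H x - u)ᵀ D (H x - u) + uᵀ C u`. -/
noncomputable def minimizer (ω : ℝ) (x : Fin d → ℝ) : Fin d ⊕ Fin d → ℝ :=
  (weight P₁ P₂ ω + Pc⁻¹)⁻¹ *ᵥ (weight P₁ P₂ ω *ᵥ (obs d *ᵥ x))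

/-- The part `H x - u` of `H x` left by `u = minimizer ω x`. -/
noncomputable def residual (ω : ℝ) (x : Fin d → ℝ) : Fin d ⊕ Fin d → ℝ :=
  obs d *ᵥ x - minimizer P₁ P₂ Pc ω x

/-- The derivative of `xᵀ A_F(ω) x` in `ω`. -/
noncomputable def slope (ω : ℝ) (x : Fin d → ℝ) : ℝ :=
  (residual P₁ P₂ Pc ω x ∘ Sum.inl) ⬝ᵥ (P₁⁻¹ *ᵥ (residual P₁ P₂ Pc ω x ∘ Sum.inl)) -
    (residual P₁ P₂ Pc ω x ∘ Sum.inr) ⬝ᵥ (P₂⁻¹ *ᵥ (residual P₁ P₂ Pc ω x ∘ Sum.inr))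

/-- The first-order condition for `ω` to maximize `xᵀ A_F(ω) x` over `[0, 1]`. -/
def Stationary (ω : ℝ) (x : Fin d → ℝ) : Prop :=
  (ω < 1 → slope P₁ P₂ Pc ω x ≤ 0) ∧ (0 < ω → 0 ≤ slope P₁ P₂ Pc ω x)

theorem obs_mulVec (x : Fin d → ℝ) : obs d *ᵥ x = Sum.elim x x := by
  simp [obs, fromRows_mulVec]

theorem obs_mulVec_eq_zero {x : Fin d → ℝ} : obs d *ᵥ x = 0 ↔ x = 0 := by
  rw [obs_mulVec]
  refine ⟨fun h => ?_, fun h => by subst h; ext (i | i) <;> rfl⟩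
  ext i
  exact congrFun h (Sum.inl i)

theorem quadratic_obs (N : Matrix (Fin d ⊕ Fin d) (Fin d ⊕ Fin d) ℝ) (x : Fin d → ℝ) :
    x ⬝ᵥ (((obs d)ᵀ * N * obs d) *ᵥ x) = (obs d *ᵥ x) ⬝ᵥ (N *ᵥ (obs d *ᵥ x)) := by
  rw [← mulVec_mulVec, ← mulVec_mulVec, dotProduct_mulVec, vecMul_transpose]

theorem quadratic_weight (ω : ℝ) (z : Fin d ⊕ Fin d → ℝ) :
    z ⬝ᵥ (weight P₁ P₂ ω *ᵥ z) =
      ω * ((z ∘ Sum.inl) ⬝ᵥ (P₁⁻¹ *ᵥ (z ∘ Sum.inl))) +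
        (1 - ω) * ((z ∘ Sum.inr) ⬝ᵥ (P₂⁻¹ *ᵥ (z ∘ Sum.inr))) := by
  conv_lhs => rw [weight, fromBlocks_mulVec, ← Sum.elim_comp_inl_inr z]
  rw [sumElim_dotProduct_sumElim]
  simp [smul_mulVec]

theorem continuous_weight : Continuous (weight P₁ P₂) := by
  unfold weight
  fun_prop

variable {P₁ P₂ Pc} (hP₁ : P₁.PosDef) (hP₂ : P₂.PosDef) (hPc : Pc.PosDef)
include hP₁ hP₂

theorem isHermitian_weight (ω : ℝ) : (weight P₁ P₂ ω).IsHermitian := by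
  have h1 := hP₁.inv.1
  have h2 := hP₂.inv.1
  refine IsHermitian.fromBlocks (h1.smul (IsSelfAdjoint.all _)) (by simp)
    (h2.smul (IsSelfAdjoint.all _))

theorem posSemidef_weight {ω : ℝ} (hω : ω ∈ Set.Icc (0 : ℝ) 1) : (weight P₁ P₂ ω).PosSemidef := by
  refine .of_dotProduct_mulVec_nonneg (isHermitian_weight hP₁ hP₂ ω) fun z => ?_
  rw [star_trivial, quadratic_weight]
  have h1 := PosSemidef.dotProduct_mulVec_self_nonneg hP₁.inv.posSemidef (z ∘ Sum.inl)
  have h2 := PosSemidef.dotProduct_mulVec_self_nonneg hP₂.inv.posSemidef (z ∘ Sum.inr)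
  exact add_nonneg (mul_nonneg hω.1 h1) (mul_nonneg (sub_nonneg.2 hω.2) h2)

include hPc

theorem posDef_weight_add {ω : ℝ} (hω : ω ∈ Set.Icc (0 : ℝ) 1) :
    (weight P₁ P₂ ω + Pc⁻¹).PosDef :=
  PosDef.posSemidef_add (posSemidef_weight hP₁ hP₂ hω) hPc.inv

/-- The fused precision is the infimal convolution of D(ω) and Pc⁻¹ at Hx. The last term measures
the distance of v from the minimizer, and its positivity is the source of strict concavity. -/
theorem objective_eq {ω : ℝ} (hω : ω ∈ Set.Icc (0 : ℝ) 1) (x : Fin d → ℝ)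
    (v : Fin d ⊕ Fin d → ℝ) :
    (obs d *ᵥ x - v) ⬝ᵥ (weight P₁ P₂ ω *ᵥ (obs d *ᵥ x - v)) + v ⬝ᵥ (Pc⁻¹ *ᵥ v) =
      x ⬝ᵥ (regularPrecision P₁ P₂ Pc ω *ᵥ x) +
        (v - minimizer P₁ P₂ Pc ω x) ⬝ᵥ
          ((weight P₁ P₂ ω + Pc⁻¹) *ᵥ (v - minimizer P₁ P₂ Pc ω x)) := by
  rw [regularPrecision, quadratic_obs]
  exact quadratic_sub_add_quadratic (isHermitian_weight hP₁ hP₂ ω)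
    (posDef_weight_add hP₁ hP₂ hPc hω) _ _

theorem quadratic_regularPrecision_le {ω : ℝ} (hω : ω ∈ Set.Icc (0 : ℝ) 1) (x : Fin d → ℝ)
    (v : Fin d ⊕ Fin d → ℝ) :
    x ⬝ᵥ (regularPrecision P₁ P₂ Pc ω *ᵥ x) ≤
    (obs d *ᵥ x - v) ⬝ᵥ (weight P₁ P₂ ω *ᵥ (obs d *ᵥ x - v)) + v ⬝ᵥ (Pc⁻¹ *ᵥ v) := by
  rw [objective_eq hP₁ hP₂ hPc hω]
  exact le_add_of_nonneg_right (PosSemidef.dotProduct_mulVec_self_nonneg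
    (posDef_weight_add hP₁ hP₂ hPc hω).posSemidef _)

theorem quadratic_regularPrecision {ω : ℝ} (hω : ω ∈ Set.Icc (0 : ℝ) 1) (x : Fin d → ℝ) :
    x ⬝ᵥ (regularPrecision P₁ P₂ Pc ω *ᵥ x) =
      residual P₁ P₂ Pc ω x ⬝ᵥ (weight P₁ P₂ ω *ᵥ residual P₁ P₂ Pc ω x) +
        minimizer P₁ P₂ Pc ω x ⬝ᵥ (Pc⁻¹ *ᵥ minimizer P₁ P₂ Pc ω x) := by
  have h := objective_eq hP₁ hP₂ hPc hω x (minimizer P₁ P₂ Pc ω x)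
  rw [sub_self, zero_dotProduct, add_zero] at h
  exact h.symm

/-- The Euler equation of the minimization over v. -/
theorem minimizer_spec {ω : ℝ} (hω : ω ∈ Set.Icc (0 : ℝ) 1) (x : Fin d → ℝ) :
    Pc⁻¹ *ᵥ minimizer P₁ P₂ Pc ω x = weight P₁ P₂ ω *ᵥ residual P₁ P₂ Pc ω x := by
  have h : (weight P₁ P₂ ω + Pc⁻¹) *ᵥ minimizer P₁ P₂ Pc ω x = weight P₁ P₂ ω *ᵥ (obs d *ᵥ x) :=
    PosDef.mulVec_inv_mulVec (posDef_weight_add hP₁ hP₂ hPc hω) _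
  rw [residual, mulVec_sub, ← h, add_mulVec, add_sub_cancel_left]

/-- Freezing the minimizer for ω leaves a function affine in the weight ω', which bounds the minimum
at ω' from above. -/
theorem objective_minimizer {ω ω' : ℝ} (hω : ω ∈ Set.Icc (0 : ℝ) 1) (x : Fin d → ℝ) :
    residual P₁ P₂ Pc ω x ⬝ᵥ (weight P₁ P₂ ω' *ᵥ residual P₁ P₂ Pc ω x) +
        minimizer P₁ P₂ Pc ω x ⬝ᵥ (Pc⁻¹ *ᵥ minimizer P₁ P₂ Pc ω x) =
      x ⬝ᵥ (regularPrecision P₁ P₂ Pc ω *ᵥ x) + (ω' - ω) * slope P₁ P₂ Pc ω x := by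
  rw [quadratic_regularPrecision hP₁ hP₂ hPc hω, quadratic_weight, quadratic_weight, slope]
  ring

/-- `slope` is a strict supergradient of the concave function `ω ↦ xᵀ A_F(ω) x`. -/
theorem quadratic_regularPrecision_lt {ω ω' : ℝ} (hω : ω ∈ Set.Icc (0 : ℝ) 1)
    (hω' : ω' ∈ Set.Icc (0 : ℝ) 1) (hne : ω' ≠ ω) {x : Fin d → ℝ} (hx : x ≠ 0) :
    x ⬝ᵥ (regularPrecision P₁ P₂ Pc ω' *ᵥ x) <
      x ⬝ᵥ (regularPrecision P₁ P₂ Pc ω *ᵥ x) + (ω' - ω) * slope P₁ P₂ Pc ω x := by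
  rw [← objective_minimizer hP₁ hP₂ hPc hω, residual, objective_eq hP₁ hP₂ hPc hω']
  refine lt_add_of_pos_right _ (PosDef.dotProduct_mulVec_self_pos
    (posDef_weight_add hP₁ hP₂ hPc hω') fun h => hx ?_)
  -- Equality would need one minimizer for both weights. Their Euler equations then give D(ω) z =
  -- D(ω') z for the common residual z, so z = 0; hence the minimizer vanishes too, and with it Hx.
  have hu : minimizer P₁ P₂ Pc ω x = minimizer P₁ P₂ Pc ω' x := sub_eq_zero.1 h
  have hr : residual P₁ P₂ Pc ω x = residual P₁ P₂ Pc ω' x := by rw [residual, residual, hu]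
  have e1 := minimizer_spec hP₁ hP₂ hPc hω x
  have e2 := minimizer_spec hP₁ hP₂ hPc hω' x
  rw [hu, e2, hr] at e1
  set z := residual P₁ P₂ Pc ω' x with hz
  have e3 : ∀ t, weight P₁ P₂ t *ᵥ z =
      Sum.elim (t • (P₁⁻¹ *ᵥ (z ∘ Sum.inl))) ((1 - t) • (P₂⁻¹ *ᵥ (z ∘ Sum.inr))) := fun t => by
    rw [weight, fromBlocks_mulVec]
    simp [smul_mulVec]
  rw [e3, e3] at e1
  have l1 : P₁⁻¹ *ᵥ (z ∘ Sum.inl) = 0 := by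
    ext i
    have := congrFun e1 (Sum.inl i)
    simp only [Sum.elim_inl, Pi.smul_apply, smul_eq_mul] at this
    exact (mul_eq_zero.1 (by linarith : (ω' - ω) * _ = 0)).resolve_left (sub_ne_zero.2 hne)
  have l2 : P₂⁻¹ *ᵥ (z ∘ Sum.inr) = 0 := by
    ext i
    have := congrFun e1 (Sum.inr i)
    simp only [Sum.elim_inr, Pi.smul_apply, smul_eq_mul] at this
    exact (mul_eq_zero.1 (by linarith : (ω' - ω) * _ = 0)).resolve_left (sub_ne_zero.2 hne)
  have z1 : z ∘ Sum.inl = 0 := by rw [← PosDef.mulVec_inv_mulVec hP₁ (z ∘ Sum.inl), l1, mulVec_zero]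
  have z2 : z ∘ Sum.inr = 0 := by rw [← PosDef.mulVec_inv_mulVec hP₂ (z ∘ Sum.inr), l2, mulVec_zero]
  have z0 : z = 0 := by
    rw [← Sum.elim_comp_inl_inr z, z1, z2]
    ext (i | i) <;> rfl
  rw [z0, mulVec_zero] at e2
  have hm : minimizer P₁ P₂ Pc ω' x = 0 := by
    rw [← PosDef.mulVec_inv_mulVec hPc (minimizer P₁ P₂ Pc ω' x), e2, mulVec_zero]
  rw [residual, hm, sub_zero] at hz
  exact obs_mulVec_eq_zero.1 (hz.symm.trans z0)

theorem Stationary.quadratic_lt {ω ω' : ℝ} {x : Fin d → ℝ} (h : Stationary P₁ P₂ Pc ω x)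
    (hω : ω ∈ Set.Icc (0 : ℝ) 1) (hω' : ω' ∈ Set.Icc (0 : ℝ) 1) (hne : ω' ≠ ω) (hx : x ≠ 0) :
    x ⬝ᵥ (regularPrecision P₁ P₂ Pc ω' *ᵥ x) < x ⬝ᵥ (regularPrecision P₁ P₂ Pc ω *ᵥ x) := by
  have key := quadratic_regularPrecision_lt hP₁ hP₂ hPc hω hω' hne hx
  rcases lt_or_gt_of_ne hne with hlt | hlt
  · have := h.2 (hω'.1.trans_lt hlt)
    nlinarith
  · have := h.1 (hlt.trans_le hω'.2)
    nlinarith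

theorem posDef_regularPrecision {ω : ℝ} (hω : ω ∈ Set.Icc (0 : ℝ) 1) :
    (regularPrecision P₁ P₂ Pc ω).PosDef := by
  have hD : (weight P₁ P₂ ω)ᵀ = weight P₁ P₂ ω :=
    isHermitian_weight hP₁ hP₂ ω
  have hW := posDef_weight_add hP₁ hP₂ hPc hω
  have hWi : ((weight P₁ P₂ ω + Pc⁻¹)⁻¹)ᵀ = (weight P₁ P₂ ω + Pc⁻¹)⁻¹ :=
    hW.inv.1
  refine .of_dotProduct_mulVec_pos ?_ fun x hx => ?_
  · rw [IsHermitian, conjTranspose_eq_transpose_of_trivial, regularPrecision]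
    simp only [transpose_mul, transpose_sub, transpose_transpose, hD, hWi, Matrix.mul_assoc]
  · rw [star_trivial, quadratic_regularPrecision hP₁ hP₂ hPc hω]
    have h1 := PosSemidef.dotProduct_mulVec_self_nonneg (posSemidef_weight hP₁ hP₂ hω)
      (residual P₁ P₂ Pc ω x)
    have h2 := PosSemidef.dotProduct_mulVec_self_nonneg hPc.inv.posSemidef
      (minimizer P₁ P₂ Pc ω x)
    -- A zero minimizer forces D(ω) H x = 0, which for x ≠ 0 needs both weights ω and 1 - ω to
    -- vanish.
    by_cases hu : minimizer P₁ P₂ Pc ω x = 0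
    · exfalso
      have e := minimizer_spec hP₁ hP₂ hPc hω x
      rw [residual, hu, sub_zero, mulVec_zero, obs_mulVec, weight, fromBlocks_mulVec] at e
      have hz : ∀ {P : Matrix (Fin d) (Fin d) ℝ} {t : ℝ}, P.PosDef → t • (P⁻¹ *ᵥ x) = 0 →
          t = 0 := fun {P t} hP h => by
        refine (smul_eq_zero.1 h).resolve_right fun h' => hx ?_
        rw [← PosDef.mulVec_inv_mulVec hP x, h', mulVec_zero]
      have a1 : ω = 0 := hz hP₁ (by
        ext i; simpa [smul_mulVec] using (congrFun e (Sum.inl i)).symm)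
      have a2 : 1 - ω = 0 := hz hP₂ (by
        ext i; simpa [smul_mulVec] using (congrFun e (Sum.inr i)).symm)
      linarith
    · have h3 := PosDef.dotProduct_mulVec_self_pos hPc.inv hu
      linarith

/-! ### Homogeneity, continuity and existence of a stationary weight -/

omit hP₁ hP₂ hPc

theorem minimizer_smul (ω c : ℝ) (x : Fin d → ℝ) :
    minimizer P₁ P₂ Pc ω (c • x) = c • minimizer P₁ P₂ Pc ω x := by
  simp only [minimizer, mulVec_smul]

theorem residual_smul (ω c : ℝ) (x : Fin d → ℝ) :
    residual P₁ P₂ Pc ω (c • x) = c • residual P₁ P₂ Pc ω x := by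
  simp only [residual, minimizer_smul, mulVec_smul, smul_sub]

theorem slope_smul (ω c : ℝ) (x : Fin d → ℝ) :
    slope P₁ P₂ Pc ω (c • x) = c ^ 2 * slope P₁ P₂ Pc ω x := by
  simp only [slope, residual_smul]
  have h1 : ∀ z : Fin d ⊕ Fin d → ℝ, (c • z) ∘ Sum.inl = c • (z ∘ Sum.inl) := fun _ => rfl
  have h2 : ∀ z : Fin d ⊕ Fin d → ℝ, (c • z) ∘ Sum.inr = c • (z ∘ Sum.inr) := fun _ => rfl
  rw [h1, h2, quadratic_smul, quadratic_smul, mul_sub]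

theorem continuous_slope_right (ω : ℝ) : Continuous (slope P₁ P₂ Pc ω) := by
  unfold slope residual minimizer
  fun_prop

include hP₁ hP₂ hPc

theorem continuousAt_inv_weight_add {ω : ℝ} (hω : ω ∈ Set.Icc (0 : ℝ) 1) :
    ContinuousAt (fun ω => (weight P₁ P₂ ω + Pc⁻¹)⁻¹) ω :=
  continuousAt_inv ((continuous_weight P₁ P₂).add continuous_const).continuousAt
    (posDef_weight_add hP₁ hP₂ hPc hω).det_pos.ne'

theorem continuousAt_regularPrecision {ω : ℝ} (hω : ω ∈ Set.Icc (0 : ℝ) 1) :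
    ContinuousAt (regularPrecision P₁ P₂ Pc) ω := by
  have h1 := continuousAt_inv_weight_add hP₁ hP₂ hPc hω
  have h2 := (continuous_weight P₁ P₂).continuousAt (x := ω)
  have hc : Continuous fun N : Matrix (Fin d ⊕ Fin d) (Fin d ⊕ Fin d) ℝ =>
      (obs d)ᵀ * N * obs d := by fun_prop
  exact hc.continuousAt.comp (h2.sub ((h2.mul h1).mul h2))

theorem continuousAt_quadratic_regularPrecision {ω : ℝ} (hω : ω ∈ Set.Icc (0 : ℝ) 1)
    (x : Fin d → ℝ) :
    ContinuousAt (fun t => x ⬝ᵥ (regularPrecision P₁ P₂ Pc t *ᵥ x)) ω := by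
  have hc : Continuous fun N : Matrix (Fin d) (Fin d) ℝ => x ⬝ᵥ (N *ᵥ x) := by fun_prop
  exact hc.continuousAt.comp (continuousAt_regularPrecision hP₁ hP₂ hPc hω)

theorem continuousAt_slope_left {ω : ℝ} (hω : ω ∈ Set.Icc (0 : ℝ) 1) (x : Fin d → ℝ) :
    ContinuousAt (fun t => slope P₁ P₂ Pc t x) ω := by
  have h1 := continuousAt_inv_weight_add hP₁ hP₂ hPc hω
  have h2 := (continuous_weight P₁ P₂).continuousAt (x := ω)
  have hc : Continuous fun N : Matrix (Fin d ⊕ Fin d) (Fin d ⊕ Fin d) ℝ =>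
      obs d *ᵥ x - N *ᵥ (obs d *ᵥ x) := by fun_prop
  have hr : ContinuousAt (fun t => residual P₁ P₂ Pc t x) ω := by
    have h := hc.continuousAt.comp (h1.mul h2)
    refine h.congr (.of_forall fun t => ?_)
    simp [residual, minimizer, Matrix.mul_assoc]
  have hq : Continuous fun z : Fin d ⊕ Fin d → ℝ =>
      (z ∘ Sum.inl) ⬝ᵥ (P₁⁻¹ *ᵥ (z ∘ Sum.inl)) - (z ∘ Sum.inr) ⬝ᵥ (P₂⁻¹ *ᵥ (z ∘ Sum.inr)) := by
    fun_prop
  exact hq.continuousAt.comp hr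

/-- Either an endpoint qualifies, or the slope is positive at 0 and negative at 1 and has a zero in
between. -/
theorem exists_stationary (x : Fin d → ℝ) :
    ∃ ω ∈ Set.Icc (0 : ℝ) 1, Stationary P₁ P₂ Pc ω x := by
  by_cases h0 : slope P₁ P₂ Pc 0 x ≤ 0
  · exact ⟨0, by simp, fun _ => h0, fun h => absurd h (lt_irrefl _)⟩
  by_cases h1 : 0 ≤ slope P₁ P₂ Pc 1 x
  · exact ⟨1, by simp, fun h => absurd h (lt_irrefl _), fun _ => h1⟩
  have hc : ContinuousOn (fun t => slope P₁ P₂ Pc t x) (Set.Icc 0 1) := fun t ht =>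
    (continuousAt_slope_left hP₁ hP₂ hPc ht x).continuousWithinAt
  obtain ⟨ω, hω, h⟩ := intermediate_value_Icc' zero_le_one hc
    ⟨(not_le.1 h1).le, (not_le.1 h0).le⟩
  exact ⟨ω, hω, fun _ => h.le, fun _ => h.ge⟩

end ESCI
-- Duality: g as the maximum of the fused precisions
namespace ESCI

variable {d : ℕ} {P₁ P₂ : Matrix (Fin d) (Fin d) ℝ} {Pc : Matrix (Fin d ⊕ Fin d) (Fin d ⊕ Fin d) ℝ}

theorem posDef_obs {N : Matrix (Fin d ⊕ Fin d) (Fin d ⊕ Fin d) ℝ} (hN : N.PosDef) :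
    ((obs d)ᵀ * N * obs d).PosDef := by
  refine .of_dotProduct_mulVec_pos ?_ fun x hx => ?_
  · have h : Nᵀ = N := hN.1
    rw [IsHermitian, conjTranspose_eq_transpose_of_trivial]
    simp only [transpose_mul, transpose_transpose, h, Matrix.mul_assoc]
  · rw [star_trivial, quadratic_obs]
    exact hN.dotProduct_mulVec_self_pos (obs_mulVec_eq_zero.not.2 hx)

theorem inv_optFusedCov {P : Matrix (Fin d ⊕ Fin d) (Fin d ⊕ Fin d) ℝ} (hP : P.PosDef) :
    (optFusedCov P)⁻¹ = (obs d)ᵀ * P⁻¹ * obs d :=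
  nonsing_inv_nonsing_inv _ (posDef_obs hP.inv).det_pos.ne'.isUnit

theorem posDef_of_mem_admissible (hPc : Pc.PosDef) {P : Matrix (Fin d ⊕ Fin d) (Fin d ⊕ Fin d) ℝ}
    (hP : P ∈ admissible P₁ P₂ Pc) : P.PosDef := by
  obtain ⟨R, hR, -, -, rfl⟩ := hP
  exact PosDef.posSemidef_add hR hPc

/-- A diagonal block of a positive semidefinite matrix `R` bounds the corresponding part of
`R p` by `pᵀ R p`. -/
theorem quadratic_inv_submatrix_le {m n : Type*} [Fintype m] [Fintype n] [DecidableEq m]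
    {R : Matrix n n ℝ} (hR : R.PosSemidef) (f : m → n) (hf : (R.submatrix f f).PosDef)
    (p : n → ℝ) :
    ((R *ᵥ p) ∘ f) ⬝ᵥ ((R.submatrix f f)⁻¹ *ᵥ ((R *ᵥ p) ∘ f)) ≤ p ⬝ᵥ (R *ᵥ p) := by
  classical
  set w := (R *ᵥ p) ∘ f with hw
  set a := (R.submatrix f f)⁻¹ *ᵥ w
  have hRa : R.submatrix f f *ᵥ a = w := hf.mulVec_inv_mulVec w
  -- The vector a pushed forward along f. Nonnegativity of the form of R at p - b is the claim.
  let b : n → ℝ := fun i => ∑ j, if f j = i then a j else 0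
  have hb : ∀ v : n → ℝ, b ⬝ᵥ v = a ⬝ᵥ (v ∘ f) := fun v => by
    simp only [b, dotProduct, Finset.sum_mul]
    rw [Finset.sum_comm]
    simp
  have hRb : (R *ᵥ b) ∘ f = w := by
    rw [← hRa]
    ext j
    simp only [Function.comp_apply, mulVec]
    rw [dotProduct_comm, hb, dotProduct_comm]
    rfl
  have h := hR.dotProduct_mulVec_self_nonneg (p + (-1 : ℝ) • b)
  rw [quadratic_add_smul hR.1, dotProduct_mulVec_comm_of_isHermitian hR.1 p b, hb, hb, hRb,
    dotProduct_comm a, ← hw] at h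
  linarith

/-- For p = (R + Pc)⁻¹ H x, the trial vector v = Pc p leaves the residual R p. Each block of R p
costs at most pᵀ R p, hence so does their weighted average, and pᵀ R p + pᵀ Pc p is the right side.
-/
theorem quadratic_regularPrecision_le_of_mem_admissible (hP₁ : P₁.PosDef) (hP₂ : P₂.PosDef)
    (hPc : Pc.PosDef) {ω : ℝ} (hω : ω ∈ Set.Icc (0 : ℝ) 1)
    {P : Matrix (Fin d ⊕ Fin d) (Fin d ⊕ Fin d) ℝ} (hP : P ∈ admissible P₁ P₂ Pc)
    (x : Fin d → ℝ) :
    x ⬝ᵥ (regularPrecision P₁ P₂ Pc ω *ᵥ x) ≤ x ⬝ᵥ ((optFusedCov P)⁻¹ *ᵥ x) := by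
  have hPd := posDef_of_mem_admissible hPc hP
  rw [inv_optFusedCov hPd, quadratic_obs]
  obtain ⟨R, hR, rfl, rfl, rfl⟩ := hP
  set p := (R + Pc)⁻¹ *ᵥ (obs d *ᵥ x)
  have hp : (R + Pc) *ᵥ p = obs d *ᵥ x := hPd.mulVec_inv_mulVec _
  have hz : obs d *ᵥ x - Pc *ᵥ p = R *ᵥ p := by rw [← hp, add_mulVec, add_sub_cancel_right]
  refine (quadratic_regularPrecision_le hP₁ hP₂ hPc hω x (Pc *ᵥ p)).trans ?_
  rw [hz, quadratic_weight, hPc.inv_mulVec_mulVec, dotProduct_comm _ p, ← hp, add_mulVec,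
    add_dotProduct, dotProduct_comm (R *ᵥ p) p, dotProduct_comm (Pc *ᵥ p) p]
  have h1 := quadratic_inv_submatrix_le hR Sum.inl hP₁ p
  have h2 := quadratic_inv_submatrix_le hR Sum.inr hP₂ p
  have h3 := mul_le_mul_of_nonneg_left h1 hω.1
  have h4 := mul_le_mul_of_nonneg_left h2 (sub_nonneg.2 hω.2)
  simp only [toBlocks₁₁, toBlocks₂₂] at *
  simp only [submatrix] at h3 h4
  linarith

/-- The covariance with blocks `P₁`, `P₂` that is correlated along `z`. -/
noncomputable def correlated (P₁ P₂ : Matrix (Fin d) (Fin d) ℝ) (z : Fin d ⊕ Fin d → ℝ) (m : ℝ) :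
    Matrix (Fin d ⊕ Fin d) (Fin d ⊕ Fin d) ℝ :=
  fromBlocks P₁ (m⁻¹ • vecMulVec (z ∘ Sum.inl) (z ∘ Sum.inr))
    (m⁻¹ • vecMulVec (z ∘ Sum.inr) (z ∘ Sum.inl)) P₂

/-- The matrix splits into diag(P₁ - m⁻¹ z₁ z₁ᵀ, P₂ - m⁻¹ z₂ z₂ᵀ) and m⁻¹ z zᵀ. The bounds on zᵢᵀ
Pᵢ⁻¹ zᵢ by m make the first part nonnegative. -/
theorem quadratic_correlated (P₁ P₂ : Matrix (Fin d) (Fin d) ℝ) (z : Fin d ⊕ Fin d → ℝ) (m : ℝ)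
    (p : Fin d ⊕ Fin d → ℝ) :
    p ⬝ᵥ (correlated P₁ P₂ z m *ᵥ p) =
      ((p ∘ Sum.inl) ⬝ᵥ (P₁ *ᵥ (p ∘ Sum.inl)) - m⁻¹ * ((z ∘ Sum.inl) ⬝ᵥ (p ∘ Sum.inl)) ^ 2) +
      ((p ∘ Sum.inr) ⬝ᵥ (P₂ *ᵥ (p ∘ Sum.inr)) - m⁻¹ * ((z ∘ Sum.inr) ⬝ᵥ (p ∘ Sum.inr)) ^ 2) +
      m⁻¹ * (z ⬝ᵥ p) ^ 2 := by
  have hzp : z ⬝ᵥ p = (z ∘ Sum.inl) ⬝ᵥ (p ∘ Sum.inl) + (z ∘ Sum.inr) ⬝ᵥ (p ∘ Sum.inr) := by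
    rw [← sumElim_dotProduct_sumElim, Sum.elim_comp_inl_inr, Sum.elim_comp_inl_inr]
  conv_lhs => rw [correlated, fromBlocks_mulVec, ← Sum.elim_comp_inl_inr p]
  rw [sumElim_dotProduct_sumElim, hzp]
  simp only [Sum.elim_comp_inl, Sum.elim_comp_inr, smul_mulVec, vecMulVec_mulVec, dotProduct_add,
    dotProduct_smul, op_smul_eq_smul, smul_eq_mul,
    dotProduct_comm (p ∘ Sum.inl) (z ∘ Sum.inl), dotProduct_comm (p ∘ Sum.inr) (z ∘ Sum.inr)]
  ring

theorem sq_dotProduct_div_le_quadratic_correlated (hP₁ : P₁.PosDef) (hP₂ : P₂.PosDef)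
    {z : Fin d ⊕ Fin d → ℝ} {m : ℝ} (h₁ : (z ∘ Sum.inl) ⬝ᵥ (P₁⁻¹ *ᵥ (z ∘ Sum.inl)) ≤ m)
    (h₂ : (z ∘ Sum.inr) ⬝ᵥ (P₂⁻¹ *ᵥ (z ∘ Sum.inr)) ≤ m) (p : Fin d ⊕ Fin d → ℝ) :
    m⁻¹ * (z ⬝ᵥ p) ^ 2 ≤ p ⬝ᵥ (correlated P₁ P₂ z m *ᵥ p) := by
  rw [quadratic_correlated]
  have := hP₁.sq_dotProduct_div_le h₁ (p ∘ Sum.inl)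
  have := hP₂.sq_dotProduct_div_le h₂ (p ∘ Sum.inr)
  linarith

theorem posSemidef_correlated (hP₁ : P₁.PosDef) (hP₂ : P₂.PosDef)
    {z : Fin d ⊕ Fin d → ℝ} {m : ℝ} (h₁ : (z ∘ Sum.inl) ⬝ᵥ (P₁⁻¹ *ᵥ (z ∘ Sum.inl)) ≤ m)
    (h₂ : (z ∘ Sum.inr) ⬝ᵥ (P₂⁻¹ *ᵥ (z ∘ Sum.inr)) ≤ m) :
    (correlated P₁ P₂ z m).PosSemidef := by
  have hm : 0 ≤ m := (hP₁.inv.posSemidef.dotProduct_mulVec_self_nonneg _).trans h₁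
  refine .of_dotProduct_mulVec_nonneg ?_ fun p => ?_
  · refine IsHermitian.fromBlocks hP₁.1 ?_ hP₂.1
    rw [conjTranspose_eq_transpose_of_trivial, transpose_smul, transpose_vecMulVec]
  · rw [star_trivial]
    exact (by positivity : 0 ≤ m⁻¹ * (z ⬝ᵥ p) ^ 2).trans
      (sq_dotProduct_div_le_quadratic_correlated hP₁ hP₂ h₁ h₂ p)

/-- The covariance correlated along `z` attains the objective `m + uᵀ Pc⁻¹ u` at least. -/
theorem exists_admissible_quadratic_le (hP₁ : P₁.PosDef) (hP₂ : P₂.PosDef)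
    (hPc : Pc.PosDef) {z u : Fin d ⊕ Fin d → ℝ} {m : ℝ} {x : Fin d → ℝ} (hx : z + u = obs d *ᵥ x)
    (h₁ : (z ∘ Sum.inl) ⬝ᵥ (P₁⁻¹ *ᵥ (z ∘ Sum.inl)) ≤ m)
    (h₂ : (z ∘ Sum.inr) ⬝ᵥ (P₂⁻¹ *ᵥ (z ∘ Sum.inr)) ≤ m) :
    ∃ P ∈ admissible P₁ P₂ Pc, x ⬝ᵥ ((optFusedCov P)⁻¹ *ᵥ x) ≤ m + u ⬝ᵥ (Pc⁻¹ *ᵥ u) := by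
  have hm : 0 ≤ m := (hP₁.inv.posSemidef.dotProduct_mulVec_self_nonneg _).trans h₁
  have hmem : correlated P₁ P₂ z m + Pc ∈ admissible P₁ P₂ Pc :=
    ⟨_, posSemidef_correlated hP₁ hP₂ h₁ h₂, by simp [correlated], by simp [correlated], rfl⟩
  refine ⟨_, hmem, ?_⟩
  have hPd := posDef_of_mem_admissible hPc hmem
  rw [inv_optFusedCov hPd, quadratic_obs]
  set R := correlated P₁ P₂ z m
  set p := (R + Pc)⁻¹ *ᵥ (obs d *ᵥ x)
  have hp : (R + Pc) *ᵥ p = obs d *ᵥ x := hPd.mulVec_inv_mulVec _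
  have e1 : (obs d *ᵥ x) ⬝ᵥ p = z ⬝ᵥ p + u ⬝ᵥ p := by rw [← hx, add_dotProduct]
  have e2 : (obs d *ᵥ x) ⬝ᵥ p = p ⬝ᵥ (R *ᵥ p) + p ⬝ᵥ (Pc *ᵥ p) := by
    rw [← hp, dotProduct_comm, add_mulVec, dotProduct_add]
  -- With q = (Hx) ⬝ᵥ p, `h3` and `h5` add up to 2 q ≤ q + m + uᵀ Pc⁻¹ u.
  have h3 := hPc.two_mul_dotProduct_le p u 1
  have h4 := sq_dotProduct_div_le_quadratic_correlated hP₁ hP₂ h₁ h₂ p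
  have h5 : 2 * (z ⬝ᵥ p) ≤ m + p ⬝ᵥ (R *ᵥ p) := by
    rcases hm.eq_or_lt with rfl | hpos
    · have hz : ∀ {P : Matrix (Fin d) (Fin d) ℝ} {w : Fin d → ℝ}, P.PosDef →
          w ⬝ᵥ (P⁻¹ *ᵥ w) ≤ 0 → w = 0 := fun hP hw => by
        by_contra hne
        exact hw.not_gt (hP.inv.dotProduct_mulVec_self_pos hne)
      have hz0 : z = 0 := by
        rw [← Sum.elim_comp_inl_inr z, hz hP₁ h₁, hz hP₂ h₂]
        ext (i | i) <;> rfl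
      have := (posSemidef_correlated hP₁ hP₂ h₁ h₂).dotProduct_mulVec_self_nonneg p
      rw [hz0, zero_dotProduct]
      simpa using this
    · have h6 : 0 ≤ m⁻¹ * (m - z ⬝ᵥ p) ^ 2 := by positivity
      have h7 : m⁻¹ * (m - z ⬝ᵥ p) ^ 2 = m - 2 * (z ⬝ᵥ p) + m⁻¹ * (z ⬝ᵥ p) ^ 2 := by
        field_simp
        ring
      linarith
  linarith

/-- Stationarity makes the weighted average of q₁ and q₂ equal to their maximum: they agree in the
interior, and at an endpoint the larger one has all the weight. This average can therefore serve as
m in the covariance correlated along the residual. -/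
theorem Stationary.exists_admissible (hP₁ : P₁.PosDef) (hP₂ : P₂.PosDef) (hPc : Pc.PosDef)
    {ω : ℝ} (hω : ω ∈ Set.Icc (0 : ℝ) 1) {x : Fin d → ℝ} (h : Stationary P₁ P₂ Pc ω x) :
    ∃ P ∈ admissible P₁ P₂ Pc,
      x ⬝ᵥ ((optFusedCov P)⁻¹ *ᵥ x) = x ⬝ᵥ (regularPrecision P₁ P₂ Pc ω *ᵥ x) := by
  have hq := quadratic_regularPrecision hP₁ hP₂ hPc hω x
  rw [quadratic_weight] at hq
  obtain ⟨hs1, hs2⟩ := h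
  rw [slope] at hs1 hs2
  set z := residual P₁ P₂ Pc ω x
  set q₁ := (z ∘ Sum.inl) ⬝ᵥ (P₁⁻¹ *ᵥ (z ∘ Sum.inl))
  set q₂ := (z ∘ Sum.inr) ⬝ᵥ (P₂⁻¹ *ᵥ (z ∘ Sum.inr))
  have hm : q₁ ≤ ω * q₁ + (1 - ω) * q₂ ∧ q₂ ≤ ω * q₁ + (1 - ω) * q₂ := by
    rcases hω.1.eq_or_lt with rfl | h0
    · have := hs1 one_pos
      constructor <;> linarith
    · have h2 := hs2 h0
      rcases hω.2.eq_or_lt with rfl | h1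
      · constructor <;> linarith
      · have : q₁ = q₂ := le_antisymm (by linarith [hs1 h1]) (by linarith)
        rw [this]
        constructor <;> linarith
  obtain ⟨P, hP, hle⟩ := exists_admissible_quadratic_le hP₁ hP₂ hPc
    (sub_add_cancel (obs d *ᵥ x) (minimizer P₁ P₂ Pc ω x)) hm.1 hm.2
  exact ⟨P, hP, le_antisymm (hle.trans hq.ge)
    (quadratic_regularPrecision_le_of_mem_admissible hP₁ hP₂ hPc hω hP x)⟩

theorem Stationary.isLeast (hP₁ : P₁.PosDef) (hP₂ : P₂.PosDef) (hPc : Pc.PosDef)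
    {ω : ℝ} (hω : ω ∈ Set.Icc (0 : ℝ) 1) {x : Fin d → ℝ} (h : Stationary P₁ P₂ Pc ω x) :
    IsLeast (precisionValues (admissible P₁ P₂ Pc) x)
      (x ⬝ᵥ (regularPrecision P₁ P₂ Pc ω *ᵥ x)) := by
  refine ⟨h.exists_admissible hP₁ hP₂ hPc hω, ?_⟩
  rintro _ ⟨P, hP, rfl⟩
  exact quadratic_regularPrecision_le_of_mem_admissible hP₁ hP₂ hPc hω hP x

theorem Stationary.g_eq (hP₁ : P₁.PosDef) (hP₂ : P₂.PosDef) (hPc : Pc.PosDef)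
    {ω : ℝ} (hω : ω ∈ Set.Icc (0 : ℝ) 1) {x : Fin d → ℝ} (h : Stationary P₁ P₂ Pc ω x) :
    g (admissible P₁ P₂ Pc) x = x ⬝ᵥ (regularPrecision P₁ P₂ Pc ω *ᵥ x) :=
  (h.isLeast hP₁ hP₂ hPc hω).csInf_eq

theorem isLeast_g (hP₁ : P₁.PosDef) (hP₂ : P₂.PosDef) (hPc : Pc.PosDef) (x : Fin d → ℝ) :
    IsLeast (precisionValues (admissible P₁ P₂ Pc) x) (g (admissible P₁ P₂ Pc) x) := by
  obtain ⟨ω, hω, h⟩ := exists_stationary hP₁ hP₂ hPc x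
  rw [h.g_eq hP₁ hP₂ hPc hω]
  exact h.isLeast hP₁ hP₂ hPc hω

theorem quadratic_regularPrecision_le_g (hP₁ : P₁.PosDef) (hP₂ : P₂.PosDef) (hPc : Pc.PosDef)
    {ω : ℝ} (hω : ω ∈ Set.Icc (0 : ℝ) 1) (x : Fin d → ℝ) :
    x ⬝ᵥ (regularPrecision P₁ P₂ Pc ω *ᵥ x) ≤ g (admissible P₁ P₂ Pc) x := by
  obtain ⟨P, hP, h⟩ := (isLeast_g hP₁ hP₂ hPc x).1
  rw [← h]
  exact quadratic_regularPrecision_le_of_mem_admissible hP₁ hP₂ hPc hω hP x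

/-! ### Quadratic forms below g -/

/-- A quadratic form below `g` is below `xᵀ A_F(ω) x` for a single `ω`. -/
theorem exists_le_regularPrecision (hP₁ : P₁.PosDef) (hP₂ : P₂.PosDef) (hPc : Pc.PosDef)
    {S : Matrix (Fin d) (Fin d) ℝ} (hS : S.IsHermitian)
    (h : ∀ x, x ⬝ᵥ (S *ᵥ x) ≤ g (admissible P₁ P₂ Pc) x) :
    ∃ ω ∈ Set.Icc (0 : ℝ) 1, ∀ x, x ⬝ᵥ (S *ᵥ x) ≤
      x ⬝ᵥ (regularPrecision P₁ P₂ Pc ω *ᵥ x) := by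
  by_contra! hcon
  -- At a stationary ω the form of A_F(ω) equals g(x), so it cannot be below that of S there.
  have hstat : ∀ ω ∈ Set.Icc (0 : ℝ) 1, ∀ x,
      x ⬝ᵥ (regularPrecision P₁ P₂ Pc ω *ᵥ x) < x ⬝ᵥ (S *ᵥ x) →
        (ω < 1 ∧ 0 < slope P₁ P₂ Pc ω x) ∨ (0 < ω ∧ slope P₁ P₂ Pc ω x < 0) := by
    intro ω hω x hx
    by_contra! hn
    exact ((h x).trans_eq (Stationary.g_eq hP₁ hP₂ hPc hω hn)).not_gt hx
  -- The two signs of the slope do not occur for the same `ω`.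
  have hsign : ∀ ω ∈ Set.Icc (0 : ℝ) 1, ∀ x y,
      x ⬝ᵥ (regularPrecision P₁ P₂ Pc ω *ᵥ x) < x ⬝ᵥ (S *ᵥ x) →
      y ⬝ᵥ (regularPrecision P₁ P₂ Pc ω *ᵥ y) < y ⬝ᵥ (S *ᵥ y) →
      0 < slope P₁ P₂ Pc ω x → slope P₁ P₂ Pc ω y < 0 → False := by
    intro ω hω x y hx hy hsx hsy
    set N := S - regularPrecision P₁ P₂ Pc ω with hN
    have hNh : N.IsHermitian := hS.sub (posDef_regularPrecision hP₁ hP₂ hPc hω).1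
    have hNq : ∀ v, v ⬝ᵥ (N *ᵥ v) = v ⬝ᵥ (S *ᵥ v) -
        v ⬝ᵥ (regularPrecision P₁ P₂ Pc ω *ᵥ v) := fun v => by
      rw [hN, sub_mulVec, dotProduct_sub]
    have hx' : 0 < x ⬝ᵥ (N *ᵥ x) := by rw [hNq]; linarith
    -- The sign of y is free, since both forms are even. With a nonnegative cross term, N stays
    -- positive on the segment from x to y', on which the slope has a zero, against `hstat`.
    obtain ⟨y', hy', hsy', hxy⟩ : ∃ y', 0 < y' ⬝ᵥ (N *ᵥ y') ∧ slope P₁ P₂ Pc ω y' < 0 ∧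
        0 ≤ x ⬝ᵥ (N *ᵥ y') := by
      have hy' : 0 < y ⬝ᵥ (N *ᵥ y) := by rw [hNq]; linarith
      rcases le_total 0 (x ⬝ᵥ (N *ᵥ y)) with h0 | h0
      · exact ⟨y, hy', hsy, h0⟩
      · refine ⟨(-1 : ℝ) • y, ?_, ?_, ?_⟩
        · rw [quadratic_smul]; linarith
        · rw [slope_smul]; linarith
        · rw [mulVec_smul, dotProduct_smul, smul_eq_mul]; linarith
    have hc : ContinuousOn (fun t : ℝ => slope P₁ P₂ Pc ω ((1 - t) • x + t • y')) (Set.Icc 0 1) :=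
      ((continuous_slope_right ω).comp (by fun_prop :
        Continuous fun t : ℝ => (1 - t) • x + t • y')).continuousOn
    obtain ⟨t, ht, hst⟩ := intermediate_value_Icc' zero_le_one hc
      (show (0 : ℝ) ∈ _ by simpa using ⟨hsy'.le, hsx.le⟩)
    have hpos : 0 < ((1 - t) • x + t • y') ⬝ᵥ (N *ᵥ ((1 - t) • x + t • y')) := by
      rw [quadratic_add_smul hNh, quadratic_smul, smul_dotProduct, smul_eq_mul]
      have ht1 := sub_nonneg.2 ht.2
      rcases ht.1.eq_or_lt with rfl | ht0
      · simpa using hx'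
      · have := mul_pos (pow_pos ht0 2) hy'
        have := mul_nonneg (mul_nonneg ht0.le ht1) hxy
        have := mul_nonneg (sq_nonneg (1 - t)) hx'.le
        linarith
    rw [hNq] at hpos
    rcases hstat ω hω _ (sub_pos.1 hpos) with h' | h'
    · exact h'.2.ne' hst
    · exact h'.2.ne hst
  have hopen : ∀ ε : ℝ, IsOpen {ω : Set.Icc (0 : ℝ) 1 | ∃ x,
      x ⬝ᵥ (regularPrecision P₁ P₂ Pc ω *ᵥ x) < x ⬝ᵥ (S *ᵥ x) ∧
        0 < ε * slope P₁ P₂ Pc ω x} := by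
    intro ε
    rw [Set.ofPred_exists]
    refine isOpen_iUnion fun x => IsOpen.and ?_ ?_
    · refine isOpen_lt ?_ continuous_const
      exact continuous_iff_continuousAt.2 fun ω =>
        (continuousAt_quadratic_regularPrecision hP₁ hP₂ hPc ω.2 x).comp
          continuous_subtype_val.continuousAt
    · refine isOpen_lt continuous_const (continuous_const.mul ?_)
      exact continuous_iff_continuousAt.2 fun ω =>
        (continuousAt_slope_left hP₁ hP₂ hPc ω.2 x).comp
          continuous_subtype_val.continuousAt
  -- The weights with a violating vector of positive slope and those with one of negative slope form
  -- two open sets covering [0, 1]. The first contains 0 and the second 1, so by connectedness they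
  -- meet.
  obtain ⟨ω, -, ⟨x, hx, hsx⟩, ⟨y, hy, hsy⟩⟩ := isPreconnected_univ (α := Set.Icc (0 : ℝ) 1) _ _
    (hopen 1) (hopen (-1))
    (fun ω _ => by
      obtain ⟨x, hx⟩ := hcon ω ω.2
      rcases hstat ω ω.2 x hx with h' | h'
      · exact Or.inl ⟨x, hx, by linarith⟩
      · exact Or.inr ⟨x, hx, by linarith⟩)
    ⟨⟨0, by simp⟩, trivial, by
      obtain ⟨x, hx⟩ := hcon 0 (by simp)
      rcases hstat 0 (by simp) x hx with h' | h'
      · exact ⟨x, hx, by simpa using h'.2⟩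
      · exact absurd h'.1 (lt_irrefl _)⟩
    ⟨⟨1, by simp⟩, trivial, by
      obtain ⟨x, hx⟩ := hcon 1 (by simp)
      rcases hstat 1 (by simp) x hx with h' | h'
      · exact absurd h'.1 (lt_irrefl _)
      · exact ⟨x, hx, by simpa using h'.2⟩⟩
  exact hsign ω ω.2 x y hx hy (by linarith) (by linarith)

/-! ### Identification with the fused bound -/

/-- The Woodbury identity (D⁻¹ + Pc)⁻¹ = D - D (D + Pc⁻¹)⁻¹ D. Its right side makes sense for
singular D, hence also at the endpoints. -/
theorem fusedBound_eq_inv_of_mem_Ioo (hP₁ : P₁.PosDef) (hP₂ : P₂.PosDef) (hPc : Pc.PosDef)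
    {ω : ℝ} (hω : ω ∈ Set.Ioo (0 : ℝ) 1) :
    ((obs d)ᵀ * (centralBound P₁ P₂ Pc ω)⁻¹ * obs d)⁻¹ = (regularPrecision P₁ P₂ Pc ω)⁻¹ := by
  rw [regularPrecision]
  congr 3
  have hW := posDef_weight_add hP₁ hP₂ hPc (Set.Ioo_subset_Icc_self hω)
  have hW1 := mul_nonsing_inv _ hW.det_pos.ne'.isUnit
  have h0 := hω.1.ne'
  have h1 : 1 - ω ≠ 0 := (sub_pos.2 hω.2).ne'
  have hcD : fromBlocks (ω⁻¹ • P₁) 0 0 ((1 - ω)⁻¹ • P₂) * weight P₁ P₂ ω = 1 := by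
    simp [weight, fromBlocks_multiply, smul_smul, h0, h1,
      mul_nonsing_inv _ hP₁.det_pos.ne'.isUnit, mul_nonsing_inv _ hP₂.det_pos.ne'.isUnit]
  have hC := mul_nonsing_inv _ hPc.det_pos.ne'.isUnit
  refine inv_eq_right_inv ?_
  rw [centralBound]
  set G := fromBlocks (ω⁻¹ • P₁) 0 0 ((1 - ω)⁻¹ • P₂)
  set D := weight P₁ P₂ ω
  set V := (D + Pc⁻¹)⁻¹
  have e : Pc * D - Pc * D * V * D = V * D := by
    have : Pc * ((D + Pc⁻¹) * V) * D = Pc * D := by rw [hW1, Matrix.mul_one]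
    rw [Matrix.add_mul, Matrix.mul_add, ← Matrix.mul_assoc Pc Pc⁻¹, hC, Matrix.one_mul,
      Matrix.add_mul] at this
    rw [sub_eq_iff_eq_add', Matrix.mul_assoc Pc D V, ← this]
  calc (G + Pc) * (D - D * V * D) = (G * D) - (G * D) * V * D + (Pc * D - Pc * D * V * D) := by
        simp only [Matrix.add_mul, Matrix.mul_sub, Matrix.mul_assoc]
        abel
    _ = 1 := by rw [hcD, e]; simp

/-- At an endpoint both sides are limits of the same interior values. -/
theorem fusedBound_eq_inv (hP₁ : P₁.PosDef) (hP₂ : P₂.PosDef) (hPc : Pc.PosDef)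
    {ω : ℝ} (hω : ω ∈ Set.Icc (0 : ℝ) 1) :
    fusedBound P₁ P₂ Pc ω = (regularPrecision P₁ P₂ Pc ω)⁻¹ := by
  have hlim : Tendsto (fun t => ((obs d)ᵀ * (centralBound P₁ P₂ Pc t)⁻¹ * obs d)⁻¹)
      (𝓝[Set.Ioo 0 1] ω) (𝓝 (regularPrecision P₁ P₂ Pc ω)⁻¹) := by
    have hc := continuousAt_inv (continuousAt_regularPrecision hP₁ hP₂ hPc hω)
      (posDef_regularPrecision hP₁ hP₂ hPc hω).det_pos.ne'
    refine (hc.tendsto.mono_left nhdsWithin_le_nhds).congr' ?_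
    filter_upwards [self_mem_nhdsWithin] with t ht
    exact (fusedBound_eq_inv_of_mem_Ioo hP₁ hP₂ hPc ht).symm
  have hne : (𝓝[Set.Ioo (0 : ℝ) 1] ω).NeBot := by
    rw [← mem_closure_iff_nhdsWithin_neBot, closure_Ioo zero_ne_one]
    exact hω
  rcases hω.1.eq_or_lt with rfl | h0
  · exact tendsto_nhds_unique (tendsto_fusedBound_zero hP₁ hP₂ hPc) hlim
  · rcases hω.2.eq_or_lt with rfl | h1
    · exact tendsto_nhds_unique (tendsto_fusedBound_one hP₁ hP₂ hPc) hlim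
    · rw [fusedBound, if_neg h0.ne', if_neg h1.ne]
      exact fusedBound_eq_inv_of_mem_Ioo hP₁ hP₂ hPc ⟨h0, h1⟩

theorem fusedPrecision_eq (hP₁ : P₁.PosDef) (hP₂ : P₂.PosDef) (hPc : Pc.PosDef)
    {ω : ℝ} (hω : ω ∈ Set.Icc (0 : ℝ) 1) :
    fusedPrecision P₁ P₂ Pc ω = regularPrecision P₁ P₂ Pc ω := by
  rw [fusedPrecision, fusedBound_eq_inv hP₁ hP₂ hPc hω, nonsing_inv_nonsing_inv _
    (posDef_regularPrecision hP₁ hP₂ hPc hω).det_pos.ne'.isUnit]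

theorem posDef_fusedBound (hP₁ : P₁.PosDef) (hP₂ : P₂.PosDef) (hPc : Pc.PosDef)
    {ω : ℝ} (hω : ω ∈ Set.Icc (0 : ℝ) 1) : (fusedBound P₁ P₂ Pc ω).PosDef := by
  rw [fusedBound_eq_inv hP₁ hP₂ hPc hω]
  exact (posDef_regularPrecision hP₁ hP₂ hPc hω).inv

/-! ### Ellipsoid inclusions and compactness -/

theorem ellipsoid_subset_ellipsoid {P Q : Matrix (Fin d) (Fin d) ℝ} (hQ : Q.PosDef) :
    ellipsoid Q ⊆ ellipsoid P ↔ ∀ x, x ⬝ᵥ (P⁻¹ *ᵥ x) ≤ x ⬝ᵥ (Q⁻¹ *ᵥ x) := by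
  refine ⟨fun h x => ?_, fun h x hx => (h x).trans hx⟩
  by_cases hx : x = 0
  · simp [hx]
  have hpos := hQ.inv.dotProduct_mulVec_self_pos hx
  set γ := x ⬝ᵥ (Q⁻¹ *ᵥ x)
  have hc : (√γ)⁻¹ ^ 2 = γ⁻¹ := by rw [inv_pow, Real.sq_sqrt hpos.le]
  -- Homogeneity allows x to be scaled to the boundary of E(Q).
  have hmem : (√γ)⁻¹ • x ∈ ellipsoid Q := by
    rw [ellipsoid, Set.mem_ofPred_eq]
    rw [quadratic_smul, hc]
    exact (inv_mul_cancel₀ hpos.ne').le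
  have h' : (√γ)⁻¹ • x ∈ ellipsoid P := h hmem
  rw [ellipsoid, Set.mem_ofPred_eq] at h'
  rw [quadratic_smul, hc] at h'
  simpa using (inv_mul_le_iff₀ hpos).1 h'

theorem minimalVolume_subset_ellipsoid (hP₁ : P₁.PosDef) (hP₂ : P₂.PosDef) (hPc : Pc.PosDef)
    {Q : Matrix (Fin d) (Fin d) ℝ} :
    minimalVolume (admissible P₁ P₂ Pc) ⊆ ellipsoid Q ↔
      ∀ x, x ⬝ᵥ (Q⁻¹ *ᵥ x) ≤ g (admissible P₁ P₂ Pc) x := by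
  rw [minimalVolume, Set.iUnion₂_subset_iff]
  have hpd : ∀ P ∈ admissible P₁ P₂ Pc, (optFusedCov P).PosDef := fun P hP =>
    (posDef_obs (posDef_of_mem_admissible hPc hP).inv).inv
  refine ⟨fun h x => ?_, fun h P hP => (ellipsoid_subset_ellipsoid (hpd P hP)).2 fun x =>
    (h x).trans ((isLeast_g hP₁ hP₂ hPc x).2 ⟨P, hP, rfl⟩)⟩
  obtain ⟨P, hP, hx⟩ := (isLeast_g hP₁ hP₂ hPc x).1
  rw [← hx]
  exact (ellipsoid_subset_ellipsoid (hpd P hP)).1 (h P hP) x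

/-- If `xᵀ A_F(ω₁) x` stays off `g`, a multiple of the identity fits between the two. -/
theorem exists_pos_add_smul_le_g (hP₁ : P₁.PosDef) (hP₂ : P₂.PosDef) (hPc : Pc.PosDef)
    {ω₁ : ℝ} (h : ∀ x, x ≠ 0 →
      x ⬝ᵥ (regularPrecision P₁ P₂ Pc ω₁ *ᵥ x) < g (admissible P₁ P₂ Pc) x) :
    ∃ ε > 0, ∀ x, x ⬝ᵥ (regularPrecision P₁ P₂ Pc ω₁ *ᵥ x) + ε * (x ⬝ᵥ x) ≤
      g (admissible P₁ P₂ Pc) x := by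
  -- Witnessing the bound by some ω instead of by g makes `U n` a union of open sets, so no
  -- continuity of g is needed.
  let U : ℕ → Set (Fin d → ℝ) := fun n => {x | ∃ ω : Set.Icc (0 : ℝ) 1,
    x ⬝ᵥ (regularPrecision P₁ P₂ Pc ω₁ *ᵥ x) + 1 / ((n : ℝ) + 1) * (x ⬝ᵥ x) <
      x ⬝ᵥ (regularPrecision P₁ P₂ Pc ω *ᵥ x)}
  have hU : ∀ n, IsOpen (U n) := fun n => by
    simp only [U, Set.ofPred_exists]
    exact isOpen_iUnion fun ω => isOpen_lt (by fun_prop) (by fun_prop)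
  have hmono : Monotone U := by
    rintro m n hmn x ⟨ω, hx⟩
    refine ⟨ω, lt_of_le_of_lt ?_ hx⟩
    have := Nat.one_div_le_one_div (α := ℝ) hmn
    have hxx : 0 ≤ x ⬝ᵥ x := by simpa using dotProduct_star_self_nonneg x
    gcongr
  have hcover : Metric.sphere (0 : Fin d → ℝ) 1 ⊆ ⋃ n, U n := by
    intro x hx
    have hx0 : x ≠ 0 := ne_zero_of_mem_unit_sphere ⟨x, hx⟩
    obtain ⟨ω, hω, hs⟩ := exists_stationary hP₁ hP₂ hPc x
    have hlt := h x hx0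
    rw [hs.g_eq hP₁ hP₂ hPc hω] at hlt
    have hxx : 0 < x ⬝ᵥ x := by simpa using dotProduct_star_self_pos_iff.2 hx0
    obtain ⟨n, hn⟩ := exists_nat_one_div_lt (div_pos (sub_pos.2 hlt) hxx)
    rw [lt_div_iff₀ hxx] at hn
    exact Set.mem_iUnion.2 ⟨n, ⟨ω, hω⟩, by linarith⟩
  obtain ⟨n, hn⟩ := (isCompact_sphere (0 : Fin d → ℝ) 1).elim_directed_cover U hU hcover
    hmono.directed_le
  refine ⟨1 / ((n : ℝ) + 1), by positivity, fun x => ?_⟩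
  by_cases hx : x = 0
  · subst hx
    simpa using quadratic_regularPrecision_le_g hP₁ hP₂ hPc (ω := 0) (by simp) (0 : Fin d → ℝ)
  have hnx : 0 < ‖x‖ := norm_pos_iff.2 hx
  obtain ⟨ω, hω⟩ := hn (show ‖x‖⁻¹ • x ∈ Metric.sphere (0 : Fin d → ℝ) 1 by
    simp [norm_smul, hnx.ne'])
  rw [quadratic_smul, quadratic_smul, smul_dotProduct, dotProduct_smul, smul_eq_mul,
    smul_eq_mul] at hω
  refine le_trans (le_of_lt ?_) (quadratic_regularPrecision_le_g hP₁ hP₂ hPc ω.2 x)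
  refine lt_of_mul_lt_mul_left ?_ (sq_nonneg ‖x‖⁻¹)
  linarith

end ESCI

/-! ### The tightness criterion -/

theorem theorem4 (d : ℕ) (hd : 0 < d) (P₁ P₂ : Matrix (Fin d) (Fin d) ℝ)
    (Pc : Matrix (Fin d ⊕ Fin d) (Fin d ⊕ Fin d) ℝ)
    (hP₁ : P₁.PosDef) (hP₂ : P₂.PosDef) (hPc : Pc.PosDef)
    (ω₁ : ℝ) (hω₁ : ω₁ ∈ Set.Icc (0 : ℝ) 1) :
    (∀ x : Fin d → ℝ, IsLeast (ESCI.precisionValues (ESCI.admissible P₁ P₂ Pc) x)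
      (ESCI.g (ESCI.admissible P₁ P₂ Pc) x)) ∧
    (ESCI.TightlyCircumscribes (ESCI.fusedBound P₁ P₂ Pc ω₁)
        (ESCI.minimalVolume (ESCI.admissible P₁ P₂ Pc)) ↔
      ∃ x : Fin d → ℝ, x ≠ 0 ∧
        ESCI.g (ESCI.admissible P₁ P₂ Pc) x =
          x ⬝ᵥ (ESCI.fusedPrecision P₁ P₂ Pc ω₁ *ᵥ x)) := by
  refine ⟨ESCI.isLeast_g hP₁ hP₂ hPc, ?_⟩
  have hBi : (ESCI.fusedBound P₁ P₂ Pc ω₁)⁻¹ = ESCI.regularPrecision P₁ P₂ Pc ω₁ :=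
    ESCI.fusedPrecision_eq hP₁ hP₂ hPc hω₁
  have hF := ESCI.posDef_regularPrecision hP₁ hP₂ hPc hω₁
  have hB := ESCI.posDef_fusedBound hP₁ hP₂ hPc hω₁
  rw [ESCI.fusedPrecision_eq hP₁ hP₂ hPc hω₁]
  constructor
  · rintro ⟨-, -, htight⟩
    by_contra! hne
    -- The inverse of A_F(ω₁) + ε I gives an ellipsoid between the volume and E(B_F(ω₁)); tightness
    -- would force ε I = 0, absurd in dimension d > 0.
    obtain ⟨ε, hε, hle⟩ := ESCI.exists_pos_add_smul_le_g hP₁ hP₂ hPc fun x hx =>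
      lt_of_le_of_ne (ESCI.quadratic_regularPrecision_le_g hP₁ hP₂ hPc hω₁ x) (hne x hx).symm
    have hE : (ESCI.regularPrecision P₁ P₂ Pc ω₁ + ε • 1).PosDef :=
      hF.add (PosDef.one.smul hε)
    have hEi := nonsing_inv_nonsing_inv _ hE.det_pos.ne'.isUnit
    have hEq : ∀ x, x ⬝ᵥ ((ESCI.regularPrecision P₁ P₂ Pc ω₁ + ε • 1) *ᵥ x) =
        x ⬝ᵥ (ESCI.regularPrecision P₁ P₂ Pc ω₁ *ᵥ x) + ε * (x ⬝ᵥ x) := fun x => by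
      simp [add_mulVec, smul_mulVec]
    have heq := htight _ hE.inv
      ((ESCI.minimalVolume_subset_ellipsoid hP₁ hP₂ hPc).2 fun x => by
        rw [hEi, hEq]; exact hle x)
      ((ESCI.ellipsoid_subset_ellipsoid hE.inv).2 fun x => by
        rw [hEi, hEq, hBi]
        have hxx : 0 ≤ x ⬝ᵥ x := by simpa using dotProduct_star_self_nonneg x
        have := mul_nonneg hε.le hxx
        linarith)
    have h1 := congrArg (·⁻¹) heq
    simp only [hBi, hEi] at h1
    have h2 := congrFun (congrFun (left_eq_add.1 h1) ⟨0, hd⟩) ⟨0, hd⟩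
    simp at h2
    exact hε.ne' h2
  · rintro ⟨x, hx, hgx⟩
    refine ⟨hB, (ESCI.minimalVolume_subset_ellipsoid hP₁ hP₂ hPc).2 fun y => ?_,
      fun Q hQ hVQ hQB => ?_⟩
    · rw [hBi]
      exact ESCI.quadratic_regularPrecision_le_g hP₁ hP₂ hPc hω₁ y
    · rw [ESCI.minimalVolume_subset_ellipsoid hP₁ hP₂ hPc] at hVQ
      rw [ESCI.ellipsoid_subset_ellipsoid hQ, hBi] at hQB
      obtain ⟨ω, hω, hle⟩ := ESCI.exists_le_regularPrecision hP₁ hP₂ hPc hQ.inv.1 hVQ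
      obtain ⟨ω₀, hω₀, hs⟩ := ESCI.exists_stationary hP₁ hP₂ hPc x
      have hg := hs.g_eq hP₁ hP₂ hPc hω₀
      -- Strict concavity at the contact vector x leaves only one maximizing weight, so ω = ω₁ and
      -- Q⁻¹ is squeezed.
      have huniq : ∀ ω' ∈ Set.Icc (0 : ℝ) 1, ESCI.g (ESCI.admissible P₁ P₂ Pc) x ≤
          x ⬝ᵥ (ESCI.regularPrecision P₁ P₂ Pc ω' *ᵥ x) → ω' = ω₀ := fun ω' hω' h' => by
        by_contra hne
        exact (hg.ge.trans h').not_gt (hs.quadratic_lt hP₁ hP₂ hPc hω₀ hω' hne hx)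
      have h1 := huniq ω₁ hω₁ hgx.le
      have h2 := huniq ω hω (hgx.trans_le ((hQB x).trans (hle x)))
      rw [h2, ← h1] at hle
      have hQi : ESCI.regularPrecision P₁ P₂ Pc ω₁ = Q⁻¹ :=
        eq_of_quadratic_eq hF.1 hQ.inv.1 fun y => le_antisymm (hQB y) (hle y)
      rw [ESCI.fusedBound_eq_inv hP₁ hP₂ hPc hω₁, hQi,
        nonsing_inv_nonsing_inv _ hQ.det_pos.ne'.isUnit]
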